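/- Let $\Pi_\ell,\Pi_e\subset\mathbb{R}^2$ be independent homogeneous Poisson point processes with densities $\lambda_\ell>0$ and $\lambda_e>0$ (the legitimate nodes and the eavesdroppers). Let $P,\sigma^2>0$, and let the power gain $g$ be a continuous, strictly decreasing real function on $(0,\infty)$ with $g(r)\to0$ as $r\to\infty$. The secrecy rate of the link from $x$ to $y$ is $$\mathcal{R}_s(x,y)=\Bigl[\log_2\Bigl(1+\tfrac{P\,g(|x-y|)}{\sigma^2}\Bigr)-\log_2\Bigl(1+\tfrac{1}{\sigma^2}\sup_{e\in\Pi_e}P\,g(|x-e|)\Bigr)\Bigr]^+ ,$$ and the (basic) Poisson $i\mathcal{S}$-graph is the directed graph with vertex set $\Pi_\ell$ and an edge from $x$ to $y\neq x$ whenever $\mathcal{R}_s(x,y)>0$. (Almost surely, this says that $y$ is closer to $x$ than every eavesdropper.) A node is in-isolated if no edge enters it, and out-isolated if no edge leaves it. Let $p_{\mathrm{in-isol}}$ and $p_{\mathrm{out-isol}}$ be the probabilities that a typical node is in-isolated, respectively out-isolated. Then $$p_{\mathrm{in-isol}}<p_{\mathrm{out-isol}} .$$ This holds in both usual senses of a typical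 node: for the Palm probabilities, that is, for the mean number of in-isolated (out-isolated) nodes of $\Pi_\ell$ in $W$ divided by $\lambda_\ell\,|W|$, for every Borel set $W\subset\mathbb{R}^2$ of area $0<|W|<\infty$; and for the probabilities that the node at the origin is in-isolated (out-isolated) in the graph with vertex set $\Pi_\ell\cup\{0\}$, defined from the same eavesdroppers. -/

import Mathlib

open MeasureTheory ProbabilityTheory Set Filter Topology
open scoped NNReal ENNReal

noncomputable section

namespace SecrecyGraph

/-- The Euclidean space `ℝ^d` in which the nodes are scattered. -/
abbrev Space (d : ℕ) : Type := EuclideanSpace ℝ (Fin d)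

/-- The counts `B ↦ #(s ∩ B)` of a point configuration `s`, over all Borel sets `B`. The product
`σ`-algebra on the codomain is the usual `σ`-algebra of point configurations. -/
def counts {d : ℕ} (s : Set (Space d)) : {B : Set (Space d) // MeasurableSet B} → ℕ∞ :=
  fun B => (s ∩ B.1).encard

/-- `N` is a homogeneous Poisson point process on `ℝ^d` with density `l`: a random locally finite
set whose number of points in a Borel set `B` of finite volume is Poisson with mean `l * vol B`, and
whose numbers of points in disjoint Borel sets are independent. -/
structure IsPoissonProcess {d : ℕ} {Ω : Type*} [MeasurableSpace Ω] (μ : Measure Ω)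
    (N : Ω → Set (Space d)) (l : ℝ≥0) : Prop where
  locallyFinite : ∀ ω (B : Set (Space d)), Bornology.IsBounded B → (N ω ∩ B).Finite
  measurable_count : ∀ B : Set (Space d), MeasurableSet B →
    Measurable fun ω => (N ω ∩ B).encard
  law_count : ∀ B : Set (Space d), MeasurableSet B → volume B ≠ ∞ →
    μ.map (fun ω => (N ω ∩ B).encard) =
      (poissonMeasure (l * (volume B).toNNReal)).map (fun n : ℕ => (n : ℕ∞))
  indep_count : ∀ (n : ℕ) (B : Fin n → Set (Space d)), (∀ i, MeasurableSet (B i)) →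
    Pairwise (Function.onFun Disjoint B) →
    iIndepFun (fun i ω => (N ω ∩ B i).encard) μ

/-- The locations of legitimate nodes and eavesdroppers of a Poisson secrecy graph: two mutually
independent homogeneous Poisson processes with densities `ll` and `le`. -/
structure IsPoissonNetwork {d : ℕ} {Ω : Type*} [MeasurableSpace Ω] (μ : Measure Ω)
    (Nl Ne : Ω → Set (Space d)) (ll le : ℝ≥0) : Prop where
  legitimate : IsPoissonProcess μ Nl ll
  eavesdroppers : IsPoissonProcess μ Ne le
  indep : IndepFun (fun ω => counts (Nl ω)) (fun ω => counts (Ne ω)) μ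

/-- A power gain as a function of the link length `r > 0` (its value at `r = 0` is left free, which
allows for gains that are singular there, such as `r⁻²`). -/
structure IsPathLoss (g : ℝ → ℝ) : Prop where
  continuousOn : ContinuousOn g (Ioi 0)
  strictAntiOn : StrictAntiOn g (Ioi 0)
  tendsto_zero : Tendsto g atTop (𝓝 0)

/-- The received power on the link from `x` to `y` with path loss only, for transmit power `P`. -/
def pathLossPower {d : ℕ} (P : ℝ) (g : ℝ → ℝ) (x y : Space d) : ℝ := P * g (dist x y)

/-- The maximum secrecy rate of the link from `x` to `y`, for received powers `Prx`, noise powers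
`vl` (legitimate) and `ve` (eavesdroppers), and non-colluding eavesdroppers located at `Ee`. The
supremum is the power received by the strongest eavesdropper, and it is `0` if there is none. -/
def secrecyRate {d : ℕ} (Prx : Space d → Space d → ℝ) (vl ve : ℝ) (Ee : Set (Space d))
    (x y : Space d) : ℝ :=
  max (Real.logb 2 (1 + Prx x y / vl) - Real.logb 2 (1 + sSup (Prx x '' Ee) / ve)) 0

/-- The intrinsically secure communications graph on the legitimate nodes `L`, with eavesdroppers
`Ee` and secrecy rate threshold `rho`. -/
def iSGraph {d : ℕ} (Prx : Space d → Space d → ℝ) (vl ve rho : ℝ) (L Ee : Set (Space d)) :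
    Digraph L where
  Adj x y := x ≠ y ∧ rho < secrecyRate Prx vl ve Ee x y

/-- The iS-graph with path loss only, equal noise powers `v` and threshold zero. -/
def basicGraph {d : ℕ} (P v : ℝ) (g : ℝ → ℝ) (L Ee : Set (Space d)) : Digraph L :=
  iSGraph (pathLossPower P g) v v 0 L Ee

/-- No edge enters `x`. -/
def InIsolated {V : Type*} (G : Digraph V) (x : V) : Prop := ∀ y, ¬ G.Adj y x

/-- No edge leaves `x`. -/
def OutIsolated {V : Type*} (G : Digraph V) (x : V) : Prop := ∀ y, ¬ G.Adj x y

/-- The Palm probability that a typical point of the point process `N` of density `l` has the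
property `A`, computed in the observation window `W`: the mean number of points in `W` that have the
property, divided by the mean number `l * vol W` of points in `W`. -/
def palmProb {d : ℕ} {Ω : Type*} [MeasurableSpace Ω] (μ : Measure Ω) (N : Ω → Set (Space d))
    (l : ℝ≥0) (W : Set (Space d)) (A : ∀ ω, N ω → Prop) : ℝ≥0∞ :=
  (∫⁻ ω, (({x : N ω | (x : Space d) ∈ W ∧ A ω x}.encard : ℕ∞) : ℝ≥0∞) ∂μ) / (l * volume W)

/-- The origin, as a node of the configuration `L ∪ {0}`. -/
def originNode {d : ℕ} (L : Set (Space d)) : (insert 0 L : Set (Space d)) :=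
  ⟨0, mem_insert 0 L⟩

end SecrecyGraph

end

/-! Fix the legitimate nodes and a point `x`, let `y` be the nearest other node, and let only the
eavesdroppers be random. Then `x` is out-isolated exactly when an eavesdropper lies in the closed
ball about `x` of radius `|x - y|`. In-isolation forces an eavesdropper into the ball of the same
radius about `y`, an event of the same probability. It also forces one into the ball about every
other node `z` whose boundary passes through `x`. Almost surely some `z` lies off the ray from `x`
through `y`; the ball about `y` is then not almost contained in the one about `z`, so the inequality
is strict (`measure_inIsolated_lt_outIsolated`).

Independence allows integrating this over the legitimate nodes and over a point `x` drawn from a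
kernel `ρ` (`lintegral_inIsolated_lt_outIsolated`). Counting the nodes in `W` gives the Palm
version, and a Dirac mass at the origin gives the other, so no Slivnyak-Mecke formula is needed. -/

namespace SecrecyGraph

/-! ### Measurability on the space of configurations -/

/-- Locally finite point configurations in `ℝ^d`. -/
structure Config (d : ℕ) : Type where
  carrier : Set (Space d)
  finite_inter : ∀ B : Set (Space d), Bornology.IsBounded B → (carrier ∩ B).Finite

noncomputable instance (d : ℕ) : MeasurableSpace (Config d) :=
  MeasurableSpace.comap (fun s => counts s.1) inferInstance

namespace Config

variable {d : ℕ}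

lemma measurable_counts : Measurable fun s : Config d => counts s.1 :=
  comap_measurable _

lemma measurable_encard {B : Set (Space d)} (hB : MeasurableSet B) :
    Measurable fun s : Config d => (s.1 ∩ B).encard :=
  (measurable_pi_apply (⟨B, hB⟩ : {B : Set (Space d) // MeasurableSet B})).comp measurable_counts

lemma countable (s : Config d) : s.1.Countable := by
  have h : s.1 = ⋃ n : ℕ, s.1 ∩ Metric.closedBall 0 n := by
    rw [← inter_iUnion, Metric.iUnion_closedBall_nat, inter_univ]
  rw [h]
  exact countable_iUnion fun n => (s.2 _ Metric.isBounded_closedBall).countable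

lemma measurableSet (s : Config d) : MeasurableSet s.1 := s.countable.measurableSet

/-- The counting measure of a configuration, as a kernel. -/
noncomputable def points (d : ℕ) : Kernel (Config d) (Space d) where
  toFun s := Measure.count.restrict s.1
  measurable' := by
    refine Measure.measurable_of_measurable_coe _ fun B hB => ?_
    have h : (fun s : Config d => (Measure.count.restrict s.1 : Measure (Space d)) B) =
        fun s => (((s.1 ∩ B).encard : ℕ∞) : ℝ≥0∞) := by
      ext s
      rw [Measure.restrict_apply hB, Measure.count_apply (hB.inter s.measurableSet), inter_comm]
    rw [h]
    exact (Measurable.of_discrete (f := ((↑) : ℕ∞ → ℝ≥0∞))).comp (measurable_encard hB)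

lemma points_apply (s : Config d) {B : Set (Space d)} (hB : MeasurableSet B) :
    points d s B = (((s.1 ∩ B).encard : ℕ∞) : ℝ≥0∞) := by
  change (Measure.count.restrict s.1 : Measure (Space d)) B = _
  rw [Measure.restrict_apply hB, Measure.count_apply (hB.inter s.measurableSet), inter_comm]

/-- The number of points in a bounded set has no bound uniform in the configuration. Cutting space
into bounded shells and configurations by their count `k` in a shell gives countably many kernels,
each of mass at most `k`. -/
instance : IsSFiniteKernel (points d) := by
  classical
  let A : ℕ → Set (Space d) := disjointed fun n : ℕ => Metric.closedBall (0 : Space d) n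
  have hA : ∀ n, MeasurableSet (A n) :=
    fun n => MeasurableSet.disjointed (fun n => Metric.isClosed_closedBall.measurableSet) n
  have hAb : ∀ n, Bornology.IsBounded (A n) :=
    fun n => Metric.isBounded_closedBall.subset (disjointed_subset _ n)
  have hAu : ⋃ n, A n = univ := by rw [iUnion_disjointed, Metric.iUnion_closedBall_nat]
  have hS : ∀ n k : ℕ, MeasurableSet {s : Config d | (s.1 ∩ A n).encard = k} :=
    fun n k => measurable_encard (hA n) (MeasurableSet.of_discrete (s := {(k : ℕ∞)}))
  have h : points d = Kernel.sum fun p : ℕ × ℕ =>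
      Kernel.piecewise (hS p.1 p.2) ((points d).restrict (hA p.1)) 0 := by
    ext s B hB
    rw [Kernel.sum_apply' _ _ hB, ENNReal.tsum_prod (f := fun n k : ℕ =>
      (Kernel.piecewise (hS n k) ((points d).restrict (hA n)) 0) s B)]
    have h1 : ∀ n : ℕ, ∑' k : ℕ,
        (Kernel.piecewise (hS n k) ((points d).restrict (hA n)) 0) s B = points d s (B ∩ A n) := by
      intro n
      obtain ⟨k, hk⟩ := ENat.ne_top_iff_exists.1 (encard_ne_top_iff.2 (s.2 _ (hAb n)))
      rw [tsum_eq_single k]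
      · rw [Kernel.piecewise_apply', if_pos (by simp [hk]), Kernel.restrict_apply' _ _ _ hB]
      · intro j hj
        rw [Kernel.piecewise_apply', if_neg]
        · simp
        · simp only [mem_ofPred_eq, ← hk, Nat.cast_inj]
          exact fun h => hj h.symm
    simp only [h1]
    have hd : Pairwise (Function.onFun Disjoint fun n => B ∩ A n) := fun i j hij =>
      (disjoint_disjointed (fun n : ℕ => Metric.closedBall (0 : Space d) n) hij).mono
        inter_subset_right inter_subset_right
    rw [← measure_iUnion hd fun n => hB.inter (hA n), ← inter_iUnion, hAu, inter_univ]
  rw [h]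
  have : ∀ p : ℕ × ℕ, IsSFiniteKernel
      (Kernel.piecewise (hS p.1 p.2) ((points d).restrict (hA p.1)) 0) := by
    intro p
    have : IsFiniteKernel (Kernel.piecewise (hS p.1 p.2) ((points d).restrict (hA p.1)) 0) := by
      refine ⟨(p.2 : ℝ≥0∞), by simp, fun s => ?_⟩
      rw [Kernel.piecewise_apply']
      split_ifs with hs
      · rw [Kernel.restrict_apply' _ _ _ .univ, univ_inter, points_apply _ (hA _), hs]
        simp
      · simp
    infer_instance
  infer_instance

/-- A point exists in a section of `T` exactly when the counting kernel does not vanish there, so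
quantifiers over random points reduce to measurability of kernels. -/
lemma measurableSet_exists_mem {α : Type*} [MeasurableSpace α] {c : α → Config d}
    (hc : Measurable c) {T : Set (α × Space d)} (hT : MeasurableSet T) :
    MeasurableSet {a | ∃ y ∈ (c a).1, (a, y) ∈ T} := by
  have h := Kernel.measurable_kernel_prodMk_left (κ := (points d).comap c hc) hT
  convert h (measurableSet_singleton 0).compl using 1
  ext a
  have hTa : MeasurableSet (Prod.mk a ⁻¹' T) := measurable_prodMk_left hT
  simp only [mem_ofPred_eq, mem_preimage, mem_compl_iff, mem_singleton_iff, Kernel.comap_apply,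
    points_apply _ hTa]
  rw [← ENat.toENNReal_zero, ENat.toENNReal_inj, encard_eq_zero, ← ne_eq,
    ← nonempty_iff_ne_empty]
  rfl

end Config

/-! ### Void probabilities and almost sure properties of a Poisson process -/

namespace IsPoissonProcess

variable {d : ℕ} {Ω : Type*} [MeasurableSpace Ω] {μ : Measure Ω}
  {N : Ω → Set (Space d)} {l : ℝ≥0}

lemma measurableSet_inter_eq_empty (hN : IsPoissonProcess μ N l) {B : Set (Space d)}
    (hB : MeasurableSet B) : MeasurableSet {ω | N ω ∩ B = ∅} := by
  have h := hN.measurable_count B hB (MeasurableSet.of_discrete (s := {(0 : ℕ∞)}))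
  convert h using 1
  ext ω
  simp

lemma measure_inter_eq_empty (hN : IsPoissonProcess μ N l) {B : Set (Space d)}
    (hB : MeasurableSet B) (hv : volume B ≠ ∞) :
    μ {ω | N ω ∩ B = ∅} = ENNReal.ofReal (Real.exp (-(l * volume.real B))) := by
  have h := congrArg (fun m => m {(0 : ℕ∞)}) (hN.law_count B hB hv)
  simp only [Measure.map_apply (hN.measurable_count B hB) (MeasurableSet.of_discrete),
    Measure.map_apply (Measurable.of_discrete (f := ((↑) : ℕ → ℕ∞))) (MeasurableSet.of_discrete)]
    at h
  have h0 : ((↑) : ℕ → ℕ∞) ⁻¹' {0} = {0} := by ext; simp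
  rw [h0, poissonMeasure_singleton] at h
  convert h using 2
  · ext ω; simp
  · simp only [Measure.real, NNReal.coe_mul, pow_zero, Nat.factorial_zero, Nat.cast_one, mul_one,
      div_one]
    rfl

lemma measure_inter_eq_empty_pos (hN : IsPoissonProcess μ N l) {B : Set (Space d)}
    (hB : MeasurableSet B) (hv : volume B ≠ ∞) : 0 < μ {ω | N ω ∩ B = ∅} := by
  rw [hN.measure_inter_eq_empty hB hv]
  exact ENNReal.ofReal_pos.2 (Real.exp_pos _)

lemma measure_inter_nonempty [IsProbabilityMeasure μ] (hN : IsPoissonProcess μ N l)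
    {B : Set (Space d)} (hB : MeasurableSet B) (hv : volume B ≠ ∞) :
    μ {ω | (N ω ∩ B).Nonempty} = 1 - ENNReal.ofReal (Real.exp (-(l * volume.real B))) := by
  rw [← hN.measure_inter_eq_empty hB hv, ← prob_compl_eq_one_sub
    (hN.measurableSet_inter_eq_empty hB)]
  congr 1
  ext ω
  simp [nonempty_iff_ne_empty]

lemma measure_inter_nonempty_pos [IsProbabilityMeasure μ] (hN : IsPoissonProcess μ N l)
    (hl : 0 < l) {B : Set (Space d)} (hB : MeasurableSet B) (hv : volume B ≠ ∞)
    (h0 : volume B ≠ 0) : 0 < μ {ω | (N ω ∩ B).Nonempty} := by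
  rw [hN.measure_inter_nonempty hB hv, tsub_pos_iff_lt, ENNReal.ofReal_lt_one, Real.exp_lt_one_iff]
  have : 0 < volume.real B := ENNReal.toReal_pos h0 hv
  have : (0 : ℝ) < l := hl
  nlinarith [mul_pos this (ENNReal.toReal_pos h0 hv)]

lemma ae_notMem (hN : IsPoissonProcess μ N l) [IsProbabilityMeasure μ] (hd : d ≠ 0)
    (x : Space d) : ∀ᵐ ω ∂μ, x ∉ N ω := by
  have : Nonempty (Fin d) := Fin.pos_iff_nonempty.1 (Nat.pos_of_ne_zero hd)
  have h := hN.measure_inter_nonempty (measurableSet_singleton x) (by simp)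
  rw [Measure.real, measure_singleton] at h
  simp only [ENNReal.toReal_zero, mul_zero, neg_zero, Real.exp_zero, ENNReal.ofReal_one,
    tsub_self] at h
  rw [ae_iff]
  convert h using 3
  ext ω
  simp

/-- A half-space has infinite volume, while the count law covers finite volumes only. The half-space
contains balls of every radius `k`, whose void probabilities tend to 0. -/
lemma ae_exists_lt_inner (hN : IsPoissonProcess μ N l) (hl : 0 < l) (hd : d ≠ 0)
    {u : Space d} (hu : ‖u‖ = 1) : ∀ᵐ ω ∂μ, ∀ n : ℕ, ∃ z ∈ N ω, (n : ℝ) < inner ℝ u z := by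
  rw [ae_all_iff]
  intro n
  rw [ae_iff]
  set V : ℝ := volume.real (Metric.closedBall (0 : Space d) 1)
  have hV : 0 < V := ENNReal.toReal_pos
    (Metric.measure_closedBall_pos volume _ one_pos).ne' measure_closedBall_lt_top.ne
  have hbound : ∀ k : ℕ, μ {ω | ¬∃ z ∈ N ω, (n : ℝ) < inner ℝ u z} ≤
      ENNReal.ofReal (Real.exp (-(l * ((k : ℝ) ^ d * V)))) := by
    intro k
    have hvol : volume.real (Metric.closedBall ((n + k + 1 : ℝ) • u) (k : ℝ)) = (k : ℝ) ^ d * V := by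
      rw [Measure.real, Measure.addHaar_closedBall' _ _ k.cast_nonneg, ENNReal.toReal_mul,
        ENNReal.toReal_ofReal (by positivity), finrank_euclideanSpace_fin]
      rfl
    rw [← hvol, ← hN.measure_inter_eq_empty Metric.isClosed_closedBall.measurableSet
      measure_closedBall_lt_top.ne]
    refine measure_mono fun ω hω => ?_
    rw [mem_ofPred_eq, eq_empty_iff_forall_notMem]
    rintro z ⟨hz, hzB⟩
    refine hω ⟨z, hz, ?_⟩
    rw [Metric.mem_closedBall, dist_eq_norm] at hzB
    have h1 := (abs_le.1 (abs_real_inner_le_norm u (z - (n + k + 1 : ℝ) • u))).1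
    rw [inner_sub_right, inner_smul_right, real_inner_self_eq_norm_sq, hu] at h1
    linarith
  have hlim : Tendsto (fun k : ℕ => ENNReal.ofReal (Real.exp (-(l * ((k : ℝ) ^ d * V)))))
      atTop (𝓝 0) := by
    rw [← ENNReal.ofReal_zero]
    refine ENNReal.tendsto_ofReal (Real.tendsto_exp_neg_atTop_nhds_zero.comp ?_)
    exact (((tendsto_pow_atTop hd).comp tendsto_natCast_atTop_atTop).atTop_mul_const
      hV).const_mul_atTop (NNReal.coe_pos.2 hl)
  exact nonpos_iff_eq_zero.1 (ge_of_tendsto' hlim hbound)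

/-- Countably many half-space conditions serve all `x`, `y` at once: in a coordinate where `y - x`
does not vanish, some point lies beyond `x` on the opposite side. -/
lemma ae_not_subset_ray (hN : IsPoissonProcess μ N l) (hl : 0 < l) (hd : d ≠ 0) :
    ∀ᵐ ω ∂μ, ∀ x y : Space d, y ≠ x → ∃ z ∈ N ω, ¬ SameRay ℝ (y - x) (z - x) := by
  have h : ∀ᵐ ω ∂μ, ∀ i : Fin d, ∀ n : ℕ,
      (∃ z ∈ N ω, (n : ℝ) < z i) ∧ ∃ z ∈ N ω, (n : ℝ) < - z i := by
    rw [ae_all_iff]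
    intro i
    have h1 := hN.ae_exists_lt_inner hl hd (u := EuclideanSpace.single i 1) (by simp)
    have h2 := hN.ae_exists_lt_inner hl hd (u := - EuclideanSpace.single i 1) (by simp)
    filter_upwards [h1, h2] with ω h1 h2 n
    exact ⟨by simpa [EuclideanSpace.inner_single_left] using h1 n,
      by simpa [EuclideanSpace.inner_single_left] using h2 n⟩
  filter_upwards [h] with ω hω x y hyx
  have hi : ∃ i, (y - x) i ≠ 0 := by
    by_contra! h
    exact hyx (sub_eq_zero.1 (PiLp.ext h))
  obtain ⟨i, hi⟩ := hi
  obtain ⟨n, hn⟩ := exists_nat_gt |x i|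
  obtain ⟨hn1, hn2⟩ := abs_lt.1 hn
  have hy : 0 < ‖y - x‖ := norm_pos_iff.2 (sub_ne_zero.2 hyx)
  have key : ∀ z : Space d, (y - x) i * (z - x) i < 0 → ¬ SameRay ℝ (y - x) (z - x) := by
    intro z hz hs
    have h1 := congrArg (fun w : Space d => (y - x) i * w i) (sameRay_iff_norm_smul_eq.1 hs)
    simp only [PiLp.smul_apply, smul_eq_mul] at h1
    nlinarith [mul_neg_of_pos_of_neg hy hz,
      mul_nonneg (norm_nonneg (z - x)) (mul_self_nonneg ((y - x) i))]
  rcases lt_or_gt_of_ne hi with hi | hi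
  · obtain ⟨z, hz, hzn⟩ := (hω i n).1
    refine ⟨z, hz, key z (mul_neg_of_neg_of_pos hi ?_)⟩
    rw [PiLp.sub_apply]
    linarith
  · obtain ⟨z, hz, hzn⟩ := (hω i n).2
    refine ⟨z, hz, key z (mul_neg_of_pos_of_neg hi ?_)⟩
    rw [PiLp.sub_apply]
    linarith

lemma lintegral_encard_ne_top (hN : IsPoissonProcess μ N l) {B : Set (Space d)}
    (hB : MeasurableSet B) (hv : volume B ≠ ∞) :
    ∫⁻ ω, (((N ω ∩ B).encard : ℕ∞) : ℝ≥0∞) ∂μ ≠ ∞ := by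
  set r := l * (volume B).toNNReal
  rw [← lintegral_map (f := ((↑) : ℕ∞ → ℝ≥0∞)) Measurable.of_discrete (hN.measurable_count B hB),
    hN.law_count B hB hv, lintegral_map Measurable.of_discrete Measurable.of_discrete,
    poissonMeasure, lintegral_sum_measure]
  simp only [lintegral_smul_measure, lintegral_dirac, ENat.toENNReal_coe, smul_eq_mul]
  -- Only finiteness of the mean is needed, so the factor `n` is bounded by `2 ^ n` and absorbed
  -- into an exponential series.
  have hs : Summable fun n : ℕ => Real.exp (-r) * ((2 * (r : ℝ)) ^ n / n.factorial) :=
    (Real.summable_pow_div_factorial _).mul_left _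
  refine ne_top_of_le_ne_top hs.tsum_ofReal_ne_top (ENNReal.tsum_le_tsum fun n => ?_)
  rw [← ENNReal.ofReal_natCast, ← ENNReal.ofReal_mul (by positivity)]
  refine ENNReal.ofReal_le_ofReal ?_
  have h2 : (n : ℝ) ≤ 2 ^ n := by exact_mod_cast n.lt_two_pow_self.le
  calc Real.exp (-r) * (r : ℝ) ^ n / n.factorial * n
      ≤ Real.exp (-r) * (r : ℝ) ^ n / n.factorial * 2 ^ n := by gcongr
    _ = Real.exp (-r) * ((2 * (r : ℝ)) ^ n / n.factorial) := by rw [mul_pow]; ring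

lemma lintegral_encard_ne_zero [IsProbabilityMeasure μ] (hN : IsPoissonProcess μ N l)
    (hl : 0 < l) {B : Set (Space d)} (hB : MeasurableSet B) (hv : volume B ≠ ∞)
    (h0 : volume B ≠ 0) : ∫⁻ ω, (((N ω ∩ B).encard : ℕ∞) : ℝ≥0∞) ∂μ ≠ 0 := by
  intro h
  have hm : Measurable fun ω => (((N ω ∩ B).encard : ℕ∞) : ℝ≥0∞) :=
    (Measurable.of_discrete (f := ((↑) : ℕ∞ → ℝ≥0∞))).comp (hN.measurable_count B hB)
  rw [lintegral_eq_zero_iff hm] at h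
  refine (hN.measure_inter_nonempty_pos hl hB hv h0).ne' (measure_mono_null ?_ (ae_iff.1 h))
  intro ω hω
  simpa [nonempty_iff_ne_empty] using hω

/-- With positive probability a Poisson process hits `A` and misses `B`, unless `A` is almost
contained in `B`. -/
lemma measure_nonempty_and_empty_pos [IsProbabilityMeasure μ] (hN : IsPoissonProcess μ N l)
    (hl : 0 < l) {A B : Set (Space d)} (hA : MeasurableSet A) (hB : MeasurableSet B)
    (hAv : volume A ≠ ∞) (hBv : volume B ≠ ∞) (h0 : volume (A \ B) ≠ 0) :
    0 < μ {ω | (N ω ∩ A).Nonempty ∧ N ω ∩ B = ∅} := by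
  have hABv : volume (A \ B) ≠ ∞ := ne_top_of_le_ne_top hAv (measure_mono sdiff_subset)
  -- `A \ B` and `B` are disjoint, so hitting the first and missing the second are independent
  -- events of positive probability.
  have hind := hN.indep_count 2 ![A \ B, B]
    (by intro i; fin_cases i; exacts [hA.diff hB, hB])
    (by
      intro i j hij
      fin_cases i <;> fin_cases j
      · exact absurd rfl hij
      · exact disjoint_sdiff_left
      · exact disjoint_sdiff_right
      · exact absurd rfl hij)
  have h01 := hind.indepFun (i := 0) (j := 1) (by decide)
  have h := h01.measure_inter_preimage_eq_mul {0}ᶜ {0} .of_discrete .of_discrete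
  refine lt_of_lt_of_le ?_ (measure_mono (s := ((fun ω => (N ω ∩ (A \ B)).encard) ⁻¹' {0}ᶜ ∩
    (fun ω => (N ω ∩ B).encard) ⁻¹' {0})) ?_)
  · refine lt_of_lt_of_eq ?_ h.symm
    refine ENNReal.mul_pos ?_ ?_
    · convert (hN.measure_inter_nonempty_pos hl (hA.diff hB) hABv h0).ne' using 3
      ext ω
      simp [nonempty_iff_ne_empty]
    · convert (hN.measure_inter_eq_empty_pos hB hBv).ne' using 3
      ext ω
      simp
  · rintro ω ⟨h1, h2⟩
    simp only [mem_preimage, mem_compl_iff, mem_singleton_iff, encard_eq_zero] at h1 h2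
    exact ⟨(nonempty_iff_ne_empty.2 h1).mono (inter_subset_inter_right _ sdiff_subset), h2⟩

end IsPoissonProcess

/-! ### Comparison for fixed legitimate nodes -/

/-- Both spheres pass through `x`. Strict Cauchy-Schwarz makes `q` have positive inner product with
`y - x` and negative with `z - x`, so a small step from `x` along `q` enters the first ball and
leaves the second. -/
lemma volume_closedBall_diff_ne_zero {d : ℕ} {x y z : Space d} (hyx : y ≠ x)
    (h : ¬ SameRay ℝ (y - x) (z - x)) :
    volume (Metric.closedBall y (dist y x) \ Metric.closedBall z (dist z x)) ≠ 0 := by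
  set u := y - x
  set w := z - x
  have hu : 0 < ‖u‖ := norm_pos_iff.2 (sub_ne_zero.2 hyx)
  have hw : 0 < ‖w‖ := norm_pos_iff.2 fun h0 => h (by rw [h0]; exact SameRay.zero_right _)
  have hlt : inner ℝ u w < ‖u‖ * ‖w‖ := by
    refine lt_of_le_of_ne (real_inner_le_norm u w) fun he => h ?_
    rw [sameRay_iff_norm_smul_eq]
    exact (inner_eq_norm_mul_iff_real.1 he).symm
  set q := ‖w‖ • u - ‖u‖ • w
  have hqu : 0 < inner ℝ u q := by
    simp only [q, inner_sub_right, inner_smul_right, real_inner_self_eq_norm_sq]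
    nlinarith
  have hqw : inner ℝ w q < 0 := by
    simp only [q, inner_sub_right, inner_smul_right, real_inner_self_eq_norm_sq,
      real_inner_comm u w]
    nlinarith
  have hO : IsOpen (Metric.ball y (dist y x) \ Metric.closedBall z (dist z x)) :=
    Metric.isOpen_ball.sdiff Metric.isClosed_closedBall
  -- This is `‖u - ε • q‖ ^ 2 < ‖u‖ ^ 2` divided by `ε`. Leaving the ball about `z` puts no upper
  -- bound on `ε`.
  have key : ∃ ε : ℝ, 0 < ε ∧ ε * ‖q‖ ^ 2 < 2 * inner ℝ u q := by
    refine ⟨inner ℝ u q / (‖q‖ ^ 2 + 1), by positivity, ?_⟩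
    rw [div_mul_eq_mul_div, div_lt_iff₀ (by positivity)]
    nlinarith [sq_nonneg ‖q‖]
  obtain ⟨ε, hε, hεq⟩ := key
  have hne : (Metric.ball y (dist y x) \ Metric.closedBall z (dist z x)).Nonempty := by
    refine ⟨x + ε • q, ?_, ?_⟩
    · rw [Metric.mem_ball, dist_comm _ y, dist_eq_norm, dist_eq_norm]
      have : y - (x + ε • q) = u - ε • q := by simp only [u]; abel
      rw [this]
      refine lt_of_pow_lt_pow_left₀ 2 (norm_nonneg _) ?_
      rw [norm_sub_sq_real, norm_smul, inner_smul_right, Real.norm_of_nonneg hε.le]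
      nlinarith
    · rw [Metric.mem_closedBall, not_le, dist_comm _ z, dist_eq_norm, dist_eq_norm]
      have : z - (x + ε • q) = w - ε • q := by simp only [w]; abel
      rw [this]
      refine lt_of_pow_lt_pow_left₀ 2 (norm_nonneg _) ?_
      rw [norm_sub_sq_real w, inner_smul_right]
      nlinarith [sq_nonneg ‖ε • q‖, mul_pos_of_neg_of_neg hqw (neg_neg_of_pos hε)]
  exact ((hO.measure_pos volume hne).trans_le
    (measure_mono (sdiff_subset_sdiff_left Metric.ball_subset_closedBall))).ne'

lemma Config.exists_nearest {d : ℕ} (L : Config d) (x : Space d) (h : ∃ y ∈ L.carrier, y ≠ x) :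
    ∃ y ∈ L.carrier, y ≠ x ∧ ∀ z ∈ L.carrier, z ≠ x → dist x y ≤ dist x z := by
  obtain ⟨y₀, hy₀, hne⟩ := h
  have hf : ((L.carrier ∩ Metric.closedBall x (dist x y₀)) \ {x}).Finite :=
    (L.finite_inter _ Metric.isBounded_closedBall).subset sdiff_subset
  obtain ⟨y, ⟨⟨hy, hyb⟩, hyx⟩, hmin⟩ := hf.exists_minimalFor (fun y => dist x y) _
    ⟨y₀, ⟨⟨hy₀, by simp [dist_comm]⟩, hne⟩⟩
  refine ⟨y, hy, hyx, fun z hz hzx => ?_⟩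
  by_contra! hlt
  have hzb : z ∈ Metric.closedBall x (dist x y₀) := by
    rw [Metric.mem_closedBall, dist_comm] at hyb ⊢
    exact hlt.le.trans hyb
  exact absurd (hmin ⟨⟨hz, hzb⟩, hzx⟩ hlt.le) (not_le.2 hlt)

/-- For fixed legitimate nodes `L`, a node `x` is less likely to be in-isolated than to be
out-isolated: the nearest other node `y` reaches `x` with the same probability with which `x`
reaches `y`. -/
lemma measure_inIsolated_lt_outIsolated {d : ℕ} (hd : d ≠ 0) {Ω : Type*} [MeasurableSpace Ω]
    {μ : Measure Ω} [IsProbabilityMeasure μ] {N : Ω → Set (Space d)} {l : ℝ≥0}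
    (hN : IsPoissonProcess μ N l) (hl : 0 < l) (L : Config d)
    (hL : ∀ x y : Space d, y ≠ x → ∃ z ∈ L.carrier, ¬ SameRay ℝ (y - x) (z - x)) (x : Space d) :
    μ {ω | ∀ y ∈ L.carrier, y ≠ x → ∃ e ∈ N ω, dist y e ≤ dist y x} <
      μ {ω | ∀ y ∈ L.carrier, y ≠ x → ∃ e ∈ N ω, dist x e ≤ dist x y} := by
  have : Nonempty (Fin d) := Fin.pos_iff_nonempty.1 (Nat.pos_of_ne_zero hd)
  have hcb : ∀ y : Space d, MeasurableSet (Metric.closedBall y (dist y x)) :=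
    fun y => Metric.isClosed_closedBall.measurableSet
  have hcv : ∀ y : Space d, volume (Metric.closedBall y (dist y x)) ≠ ∞ :=
    fun y => measure_closedBall_lt_top.ne
  have hray : ∀ {y z : Space d}, ¬ SameRay ℝ (y - x) (z - x) → z ≠ x := by
    rintro y z h rfl
    exact h (by rw [sub_self]; exact SameRay.zero_right _)
  obtain ⟨y₀, hy₀⟩ := exists_ne x
  obtain ⟨z₀, hz₀, hz₀r⟩ := hL x y₀ hy₀
  obtain ⟨y, hy, hyx, hmin⟩ := L.exists_nearest x ⟨z₀, hz₀, hray hz₀r⟩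
  obtain ⟨z, hz, hzr⟩ := hL x y hyx
  set Y : Set Ω := {ω | (N ω ∩ Metric.closedBall y (dist y x)).Nonempty}
  -- On `Z` the node `y` cannot reach `x` but `z` can; this event is the gap between the two
  -- probabilities.
  set Z : Set Ω := {ω | (N ω ∩ Metric.closedBall y (dist y x)).Nonempty ∧
    N ω ∩ Metric.closedBall z (dist z x) = ∅}
  have hZpos : 0 < μ Z := hN.measure_nonempty_and_empty_pos hl (hcb y) (hcb z) (hcv y) (hcv z)
    (volume_closedBall_diff_ne_zero hyx hzr)
  have hZm : MeasurableSet Z := by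
    have : Z = {ω | N ω ∩ Metric.closedBall y (dist y x) = ∅}ᶜ ∩
        {ω | N ω ∩ Metric.closedBall z (dist z x) = ∅} := by
      ext ω
      simp [Z, nonempty_iff_ne_empty]
    rw [this]
    exact (hN.measurableSet_inter_eq_empty (hcb y)).compl.inter
      (hN.measurableSet_inter_eq_empty (hcb z))
  have hZY : Z ⊆ Y := fun ω hω => hω.1
  have hout : {ω | ∀ y ∈ L.carrier, y ≠ x → ∃ e ∈ N ω, dist x e ≤ dist x y} =
      {ω | (N ω ∩ Metric.closedBall x (dist y x)).Nonempty} := by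
    ext ω
    constructor
    · intro h
      obtain ⟨e, he, hed⟩ := h y hy hyx
      exact ⟨e, he, by rwa [Metric.mem_closedBall, dist_comm e, dist_comm y]⟩
    · rintro ⟨e, he, hed⟩ y' hy' hyx'
      refine ⟨e, he, ?_⟩
      rw [Metric.mem_closedBall, dist_comm e, dist_comm y] at hed
      exact hed.trans (hmin y' hy' hyx')
  have hYout : μ {ω | (N ω ∩ Metric.closedBall x (dist y x)).Nonempty} = μ Y := by
    rw [hN.measure_inter_nonempty Metric.isClosed_closedBall.measurableSet
      measure_closedBall_lt_top.ne, hN.measure_inter_nonempty (hcb y) (hcv y), Measure.real,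
      Measure.real, Measure.addHaar_closedBall_center, Measure.addHaar_closedBall_center volume y]
  have hin : {ω | ∀ y ∈ L.carrier, y ≠ x → ∃ e ∈ N ω, dist y e ≤ dist y x} ⊆ Y \ Z := by
    intro ω h
    obtain ⟨e, he, hed⟩ := h y hy hyx
    refine ⟨⟨e, he, by rwa [Metric.mem_closedBall, dist_comm]⟩, fun hωZ => ?_⟩
    obtain ⟨e', he', hed'⟩ := h z hz (hray hzr)
    exact (eq_empty_iff_forall_notMem.1 hωZ.2) e' ⟨he', by rwa [Metric.mem_closedBall, dist_comm]⟩
  rw [hout, hYout]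
  refine (measure_mono hin).trans_lt ?_
  rw [measure_sdiff hZY hZm.nullMeasurableSet (measure_ne_top μ Z)]
  exact ENNReal.sub_lt_self (measure_ne_top μ Y) (hZpos.trans_le (measure_mono hZY)).ne' hZpos.ne'

/-! ### From secrecy rates to distances -/

lemma IsPathLoss.pos {g : ℝ → ℝ} (hg : IsPathLoss g) {r : ℝ} (hr : 0 < r) : 0 < g r := by
  have h1 : g (r + 1) < g r := hg.strictAntiOn hr (by simp; linarith) (by linarith)
  refine lt_of_le_of_lt (le_of_tendsto hg.tendsto_zero ?_) h1
  filter_upwards [eventually_ge_atTop (r + 1)] with s hs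
  exact hg.strictAntiOn.antitoneOn (by simp; linarith) (by simp; linarith) hs

/-- By local finiteness and monotonicity of `g`, the supremum is attained at the eavesdropper
nearest to `x`. None may sit at `x` itself, since `g 0` is arbitrary. -/
lemma secrecyRate_pos_iff {d : ℕ} {P v : ℝ} (hP : 0 < P) (hv : 0 < v) {g : ℝ → ℝ}
    (hg : IsPathLoss g) (E : Config d) {x y : Space d} (hx : x ∉ E.carrier) (hxy : x ≠ y) :
    0 < secrecyRate (pathLossPower P g) v v E.carrier x y ↔
      ∀ e ∈ E.carrier, dist x y < dist x e := by
  have hd : 0 < dist x y := dist_pos.2 hxy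
  have hlog : ∀ S : ℝ, 0 ≤ S →
      (0 < max (Real.logb 2 (1 + P * g (dist x y) / v) - Real.logb 2 (1 + S / v)) 0 ↔
        S < P * g (dist x y)) := by
    intro S hS
    have h1 : 0 < P * g (dist x y) := mul_pos hP (hg.pos hd)
    rw [lt_max_iff, or_iff_left (lt_irrefl _), sub_pos,
      Real.logb_lt_logb_iff one_lt_two (by positivity) (by positivity), add_lt_add_iff_left,
      div_lt_div_iff_of_pos_right hv]
  unfold secrecyRate
  rcases E.carrier.eq_empty_or_nonempty with h0 | ⟨e₁, he₁⟩
  -- With no eavesdroppers the supremum takes the value 0, which lies below the positive received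
  -- power, as it should.
  · rw [h0, image_empty, Real.sSup_empty]
    simpa [pathLossPower] using (hlog 0 le_rfl).2 (mul_pos hP (hg.pos hd))
  · have hdist : ∀ e ∈ E.carrier, 0 < dist x e :=
      fun e he => dist_pos.2 fun h => hx (h ▸ he)
    obtain ⟨e₀, he₀, -, hmin⟩ := E.exists_nearest x ⟨e₁, he₁, fun h => hx (h ▸ he₁)⟩
    have hS : sSup (pathLossPower P g x '' E.carrier) = P * g (dist x e₀) := by
      refine IsGreatest.csSup_eq ⟨⟨e₀, he₀, rfl⟩, ?_⟩
      rintro _ ⟨e, he, rfl⟩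
      exact mul_le_mul_of_nonneg_left (hg.strictAntiOn.antitoneOn (hdist _ he₀) (hdist _ he)
        (hmin e he fun h => hx (h ▸ he))) hP.le
    rw [hS]
    refine (hlog _ (mul_pos hP (hg.pos (hdist _ he₀))).le).trans ?_
    rw [mul_lt_mul_iff_right₀ hP, hg.strictAntiOn.lt_iff_gt (hdist _ he₀) hd]
    exact ⟨fun h e he => h.trans_le (hmin e he fun h => hx (h ▸ he)), fun h => h e₀ he₀⟩

section Isolated

variable {d : ℕ} {P v : ℝ} {g : ℝ → ℝ}

lemma inIsolated_basicGraph_iff (hP : 0 < P) (hv : 0 < v) (hg : IsPathLoss g)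
    {L : Set (Space d)} (E : Config d) (hLE : ∀ y ∈ L, y ∉ E.carrier) (x : L) :
    InIsolated (basicGraph P v g L E.carrier) x ↔
      ∀ y ∈ L, y ≠ x → ∃ e ∈ E.carrier, dist y e ≤ dist y x := by
  constructor
  · intro h y hy hyx
    by_contra! hc
    exact h ⟨y, hy⟩ ⟨fun h => hyx (congrArg Subtype.val h),
      (secrecyRate_pos_iff hP hv hg E (hLE y hy) hyx).2 hc⟩
  · rintro h ⟨y, hy⟩ ⟨hne, hr⟩
    have hyx : y ≠ x := fun h => hne (Subtype.ext h)
    obtain ⟨e, he, hle⟩ := h y hy hyx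
    exact ((secrecyRate_pos_iff hP hv hg E (hLE y hy) hyx).1 hr e he).not_ge hle

lemma outIsolated_basicGraph_iff (hP : 0 < P) (hv : 0 < v) (hg : IsPathLoss g)
    {L : Set (Space d)} (E : Config d) (hLE : ∀ y ∈ L, y ∉ E.carrier) (x : L) :
    OutIsolated (basicGraph P v g L E.carrier) x ↔
      ∀ y ∈ L, y ≠ x → ∃ e ∈ E.carrier, dist (x : Space d) e ≤ dist (x : Space d) y := by
  constructor
  · intro h y hy hyx
    by_contra! hc
    exact h ⟨y, hy⟩ ⟨fun h => hyx (congrArg Subtype.val h).symm,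
      (secrecyRate_pos_iff hP hv hg E (hLE x x.2) hyx.symm).2 hc⟩
  · rintro h ⟨y, hy⟩ ⟨hne, hr⟩
    have hyx : y ≠ x := fun h => hne (Subtype.ext h.symm)
    obtain ⟨e, he, hle⟩ := h y hy hyx
    exact ((secrecyRate_pos_iff hP hv hg E (hLE x x.2) hyx.symm).1 hr e he).not_ge hle

end Isolated

/-! ### Isolation events and integration over the network -/

/-- The legitimate nodes `p.1.1` and eavesdroppers `p.1.2` for which `p.2` is in-isolated. -/
def inIsolatedSet (d : ℕ) : Set ((Config d × Config d) × Space d) :=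
  {p | ∀ y ∈ p.1.1.carrier, y ≠ p.2 → ∃ e ∈ p.1.2.carrier, dist y e ≤ dist y p.2}

/-- The legitimate nodes `p.1.1` and eavesdroppers `p.1.2` for which `p.2` is out-isolated. -/
def outIsolatedSet (d : ℕ) : Set ((Config d × Config d) × Space d) :=
  {p | ∀ y ∈ p.1.1.carrier, y ≠ p.2 → ∃ e ∈ p.1.2.carrier, dist p.2 e ≤ dist p.2 y}

lemma measurableSet_forall_exists {d : ℕ} {T : Set ((Space d × Space d) × Space d)}
    (hT : MeasurableSet T) : MeasurableSet {p : (Config d × Config d) × Space d |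
      ∀ y ∈ p.1.1.carrier, y ≠ p.2 → ∃ e ∈ p.1.2.carrier, ((p.2, y), e) ∈ T} := by
  have h1 : MeasurableSet {q : ((Config d × Config d) × Space d) × Space d |
      ∃ e ∈ q.1.1.2.carrier, (q, e) ∈
        {r : (((Config d × Config d) × Space d) × Space d) × Space d |
          ((r.1.1.2, r.1.2), r.2) ∈ T}} := by
    refine Config.measurableSet_exists_mem 
      (c := fun q : ((Config d × Config d) × Space d) × Space d => q.1.1.2) (by fun_prop) ?_
    exact (by fun_prop : Measurable fun r : (((Config d × Config d) × Space d) × Space d) ×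
      Space d => ((r.1.1.2, r.1.2), r.2)) hT
  have h2 : MeasurableSet {q : ((Config d × Config d) × Space d) × Space d | q.2 ≠ q.1.2} :=
    (measurableSet_eq_fun measurable_snd (measurable_snd.comp measurable_fst)).compl
  have h3 := Config.measurableSet_exists_mem
    (c := fun p : (Config d × Config d) × Space d => p.1.1) (by fun_prop) (h2.inter h1.compl)
  convert h3.compl using 1
  ext p
  simp

lemma measurableSet_inIsolatedSet (d : ℕ) : MeasurableSet (inIsolatedSet d) :=
  measurableSet_forall_exists (T := {q | dist q.1.2 q.2 ≤ dist q.1.2 q.1.1})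
    (measurableSet_le (by fun_prop) (by fun_prop))

lemma measurableSet_outIsolatedSet (d : ℕ) : MeasurableSet (outIsolatedSet d) :=
  measurableSet_forall_exists (T := {q | dist q.1.1 q.2 ≤ dist q.1.1 q.1.2})
    (measurableSet_le (by fun_prop) (by fun_prop))

namespace IsPoissonProcess

variable {d : ℕ} {Ω : Type*} [MeasurableSpace Ω] {μ : Measure Ω}
  {N : Ω → Set (Space d)} {l : ℝ≥0}

/-- A Poisson process as a random configuration. -/
def config (hN : IsPoissonProcess μ N l) (ω : Ω) : Config d := ⟨N ω, hN.locallyFinite ω⟩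

lemma measurable_config (hN : IsPoissonProcess μ N l) : Measurable hN.config :=
  measurable_comap_iff.2 (measurable_pi_iff.2 fun B => hN.measurable_count B.1 B.2)

end IsPoissonProcess

namespace IsPoissonNetwork

variable {d : ℕ} {Ω : Type*} [MeasurableSpace Ω] {μ : Measure Ω}
  {Nl Ne : Ω → Set (Space d)} {ll le : ℝ≥0}

lemma indepFun_config (hN : IsPoissonNetwork μ Nl Ne ll le) :
    IndepFun hN.legitimate.config hN.eavesdroppers.config μ := by
  have h := hN.indep
  rw [IndepFun_iff_Indep] at h ⊢
  have hc : ∀ f : Ω → Config d, MeasurableSpace.comap f inferInstance =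
      MeasurableSpace.comap (fun ω => counts (f ω).carrier) inferInstance :=
    fun f => MeasurableSpace.comap_comp
  rw [hc, hc]
  exact h

variable [IsProbabilityMeasure μ]

/-- The configurations of legitimate nodes and eavesdroppers, and a point attached to the former,
integrated by conditioning on the legitimate nodes. -/
lemma lintegral_kernel_eq (hN : IsPoissonNetwork μ Nl Ne ll le)
    (ρ : Kernel (Config d) (Space d)) [IsSFiniteKernel ρ]
    {B : Set ((Config d × Config d) × Space d)} (hB : MeasurableSet B) :
    ∫⁻ ω, ρ (hN.legitimate.config ω)
        {x | ((hN.legitimate.config ω, hN.eavesdroppers.config ω), x) ∈ B} ∂μ =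
      ∫⁻ p, μ {ω | ((p.1, hN.eavesdroppers.config ω), p.2) ∈ B}
        ∂(μ.map hN.legitimate.config ⊗ₘ ρ) := by
  have hml := hN.legitimate.measurable_config
  have hme := hN.eavesdroppers.measurable_config
  set L := hN.legitimate.config
  set E := hN.eavesdroppers.config
  have : IsProbabilityMeasure (μ.map L) := Measure.isProbabilityMeasure_map hml.aemeasurable
  have : IsProbabilityMeasure (μ.map E) := Measure.isProbabilityMeasure_map hme.aemeasurable
  have hF : Measurable fun q : Config d × Config d => ρ q.1 {x | (q, x) ∈ B} :=
    Kernel.measurable_kernel_prodMk_left (κ := ρ.prodMkRight (Config d)) hB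
  have hBp : MeasurableSet {q : (Config d × Space d) × Config d | ((q.1.1, q.2), q.1.2) ∈ B} :=
    (by fun_prop : Measurable fun q : (Config d × Space d) × Config d =>
      ((q.1.1, q.2), q.1.2)) hB
  have hEv : ∀ p : Config d × Space d, μ {ω | ((p.1, E ω), p.2) ∈ B} =
      μ.map E {e | ((p.1, e), p.2) ∈ B} := fun p =>
    (Measure.map_apply hme (measurable_prodMk_left hBp)).symm
  simp only [hEv]
  have hBm : Measurable fun p : Config d × Space d => μ.map E {e | ((p.1, e), p.2) ∈ B} :=
    measurable_measure_prodMk_left hBp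
  rw [Measure.lintegral_compProd hBm]
  have h1 : ∫⁻ ω, ρ (L ω) {x | ((L ω, E ω), x) ∈ B} ∂μ =
      ∫⁻ q, ρ q.1 {x | (q, x) ∈ B} ∂(μ.map fun ω => (L ω, E ω)) :=
    (lintegral_map hF (hml.prodMk hme)).symm
  rw [h1, hN.indepFun_config.map_prod_eq_prod_map_map hml.aemeasurable hme.aemeasurable,
    lintegral_prod _ hF.aemeasurable]
  refine lintegral_congr fun l => ?_
  have hBl : MeasurableSet {q : Config d × Space d | ((l, q.1), q.2) ∈ B} :=
    (by fun_prop : Measurable fun q : Config d × Space d => ((l, q.1), q.2)) hB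
  -- For fixed legitimate nodes, both sides are the product measure of one set, sliced in either
  -- order.
  change ∫⁻ e, ρ l (Prod.mk e ⁻¹' {q : Config d × Space d | ((l, q.1), q.2) ∈ B}) ∂(μ.map E) =
    ∫⁻ x, μ.map E ((fun e => (e, x)) ⁻¹' {q : Config d × Space d | ((l, q.1), q.2) ∈ B}) ∂(ρ l)
  rw [← Measure.prod_apply hBl, ← Measure.prod_apply_symm hBl]

/-- The expected number of common points vanishes: given the legitimate nodes, each is a fixed
point, which almost surely carries no eavesdropper. -/
lemma ae_disjoint (hN : IsPoissonNetwork μ Nl Ne ll le) (hd : d ≠ 0) :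
    ∀ᵐ ω ∂μ, ∀ y ∈ Nl ω, y ∉ Ne ω := by
  have hB : MeasurableSet {p : (Config d × Config d) × Space d | p.2 ∈ p.1.2.carrier} := by
    have h := Config.measurableSet_exists_mem
      (c := fun p : (Config d × Config d) × Space d => p.1.2) (by fun_prop)
      (measurableSet_eq_fun measurable_snd (measurable_snd.comp measurable_fst))
    convert h using 1
    ext p
    simp
  have h := hN.lintegral_kernel_eq (Config.points d) hB
  have h0 : ∀ p : Config d × Space d,
      μ {ω | p.2 ∈ (hN.eavesdroppers.config ω).carrier} = 0 := fun p => by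
    have h := hN.eavesdroppers.ae_notMem hd p.2
    simp only [ae_iff, not_not] at h
    exact h
  simp only [mem_ofPred_eq, h0, lintegral_zero] at h
  have hm : Measurable fun ω => Config.points d (hN.legitimate.config ω)
      {x | x ∈ (hN.eavesdroppers.config ω).carrier} :=
    (Kernel.measurable_kernel_prodMk_left
      (κ := (Config.points d).prodMkRight (Config d)) hB).comp
      (hN.legitimate.measurable_config.prodMk hN.eavesdroppers.measurable_config)
  rw [lintegral_eq_zero_iff hm] at h
  filter_upwards [h] with ω hω y hy hy'
  rw [Config.points_apply _ (B := {x | x ∈ (hN.eavesdroppers.config ω).carrier})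
    (hN.eavesdroppers.config ω).measurableSet, Pi.zero_apply, ← ENat.toENNReal_zero, ENat.toENNReal_inj, encard_eq_zero] at hω
  exact eq_empty_iff_forall_notMem.1 hω y ⟨hy, hy'⟩

/-- The kernel `ρ` selects the typical point. Nonzero total mass keeps the pointwise inequality
strict after integration, and finite mass rules out `∞ < ∞`. -/
lemma lintegral_inIsolated_lt_outIsolated (hN : IsPoissonNetwork μ Nl Ne ll le) (hd : d ≠ 0)
    (hll : 0 < ll) (hle : 0 < le) (ρ : Kernel (Config d) (Space d)) [IsSFiniteKernel ρ]
    (h0 : ∫⁻ ω, ρ (hN.legitimate.config ω) univ ∂μ ≠ 0)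
    (htop : ∫⁻ ω, ρ (hN.legitimate.config ω) univ ∂μ ≠ ∞) :
    ∫⁻ ω, ρ (hN.legitimate.config ω) {x | ((hN.legitimate.config ω, hN.eavesdroppers.config ω), x)
        ∈ inIsolatedSet d} ∂μ <
      ∫⁻ ω, ρ (hN.legitimate.config ω) {x | ((hN.legitimate.config ω, hN.eavesdroppers.config ω), x)
        ∈ outIsolatedSet d} ∂μ := by
  have hml := hN.legitimate.measurable_config
  have hme := hN.eavesdroppers.measurable_config
  have hmeas : ∀ {B : Set ((Config d × Config d) × Space d)}, MeasurableSet B →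
      Measurable fun p : Config d × Space d =>
        μ {ω | ((p.1, hN.eavesdroppers.config ω), p.2) ∈ B} := by
    intro B hB
    exact measurable_measure_prodMk_left ((by fun_prop : Measurable
      fun q : (Config d × Space d) × Ω => ((q.1.1, hN.eavesdroppers.config q.2), q.1.2)) hB)
  have hin := hmeas (measurableSet_inIsolatedSet d)
  have hout := hmeas (measurableSet_outIsolatedSet d)
  have htot : (μ.map hN.legitimate.config ⊗ₘ ρ) univ =
      ∫⁻ ω, ρ (hN.legitimate.config ω) univ ∂μ := by
    rw [Measure.compProd_apply .univ, lintegral_map (by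
      simpa using ρ.measurable_coe .univ) hml]
    rfl
  have hmlt : MeasurableSet {p : Config d × Space d |
      μ {ω | ((p.1, hN.eavesdroppers.config ω), p.2) ∈ inIsolatedSet d} <
        μ {ω | ((p.1, hN.eavesdroppers.config ω), p.2) ∈ outIsolatedSet d}} :=
    measurableSet_lt hin hout
  rw [hN.lintegral_kernel_eq ρ (measurableSet_inIsolatedSet d),
    hN.lintegral_kernel_eq ρ (measurableSet_outIsolatedSet d)]
  refine lintegral_strict_mono ?_ hout.aemeasurable ?_ ?_
  · rw [ne_eq, ← Measure.measure_univ_eq_zero, htot]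
    exact h0
  · refine ne_top_of_le_ne_top (htot ▸ htop) ?_
    rw [← lintegral_one]
    exact lintegral_mono fun p => prob_le_one
  · have key : ∀ᵐ ω ∂μ, ∀ x, μ {ω' | ((hN.legitimate.config ω, hN.eavesdroppers.config ω'), x) ∈
        inIsolatedSet d} < μ {ω' | ((hN.legitimate.config ω, hN.eavesdroppers.config ω'), x) ∈
        outIsolatedSet d} := by
      filter_upwards [hN.legitimate.ae_not_subset_ray hll hd] with ω hω x
      exact measure_inIsolated_lt_outIsolated hd hN.eavesdroppers hle _ hω x
    refine (Measure.ae_compProd_iff hmlt).2 ?_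
    refine (ae_map_iff hml.aemeasurable ?_).2
      (key.mono fun ω hω => Eventually.of_forall hω)
    have := Kernel.measurable_kernel_prodMk_left (κ := ρ) hmlt.compl
    exact this (measurableSet_singleton 0)

end IsPoissonNetwork

/-! ### The two senses of a typical node -/

lemma palmProb_inIsolated_lt_outIsolated {Ω : Type*} [MeasurableSpace Ω] {μ : Measure Ω} [IsProbabilityMeasure μ]
    {Nl Ne : Ω → Set (Space 2)} {ll le : ℝ≥0} (hll : 0 < ll) (hle : 0 < le)
    (hN : IsPoissonNetwork μ Nl Ne ll le)
    {P v : ℝ} (hP : 0 < P) (hv : 0 < v) {g : ℝ → ℝ} (hg : IsPathLoss g)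
    {W : Set (Space 2)} (hW : MeasurableSet W) (hW0 : volume W ≠ 0)
    (hWt : volume W ≠ ∞) :
      palmProb μ Nl ll W
          (fun ω x => InIsolated (basicGraph P v g (Nl ω) (Ne ω)) x) <
        palmProb μ Nl ll W
          (fun ω x => OutIsolated (basicGraph P v g (Nl ω) (Ne ω)) x) := by
  unfold palmProb
  have hl0 : (ll : ℝ≥0∞) ≠ 0 := by simpa using hll.ne'
  refine ENNReal.div_lt_div_right (by simp [hl0, hW0]) (ENNReal.mul_ne_top (by simp) hWt) ?_
  have huniv : ∀ ω, ((Config.points 2).restrict hW) (hN.legitimate.config ω) univ =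
      (((Nl ω ∩ W).encard : ℕ∞) : ℝ≥0∞) := fun ω => by
    rw [Kernel.restrict_apply' _ _ _ .univ, univ_inter, Config.points_apply _ hW]
    rfl
  have h := hN.lintegral_inIsolated_lt_outIsolated two_ne_zero hll hle
    ((Config.points 2).restrict hW)
    (by simpa only [huniv] using hN.legitimate.lintegral_encard_ne_zero hll hW hWt hW0)
    (by simpa only [huniv] using hN.legitimate.lintegral_encard_ne_top hW hWt)
  -- The graph property need agree with the measurable set `B` only almost surely, namely when no
  -- node coincides with an eavesdropper.
  have hcount : ∀ (B : Set ((Config 2 × Config 2) × Space 2)), MeasurableSet B →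
      ∀ (A : ∀ ω, Nl ω → Prop),
      (∀ᵐ ω ∂μ, ∀ x : Nl ω, A ω x ↔
        ((hN.legitimate.config ω, hN.eavesdroppers.config ω), (x : Space 2)) ∈ B) →
      ∫⁻ ω, (({x : Nl ω | (x : Space 2) ∈ W ∧ A ω x}.encard : ℕ∞) : ℝ≥0∞) ∂μ =
        ∫⁻ ω, ((Config.points 2).restrict hW) (hN.legitimate.config ω)
          {x | ((hN.legitimate.config ω, hN.eavesdroppers.config ω), x) ∈ B} ∂μ := by
    intro B hB A hA
    refine lintegral_congr_ae ?_
    filter_upwards [hA] with ω hω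
    have hBω : MeasurableSet {x | ((hN.legitimate.config ω, hN.eavesdroppers.config ω), x) ∈ B} :=
      measurable_prodMk_left hB
    rw [Kernel.restrict_apply' _ _ _ hBω, Config.points_apply _ (hBω.inter hW),
      ← Subtype.val_injective.encard_image]
    congr 2
    ext x
    constructor
    · rintro ⟨y, ⟨hyW, hyA⟩, rfl⟩
      exact ⟨y.2, (hω y).1 hyA, hyW⟩
    · rintro ⟨hx, hxB, hxW⟩
      exact ⟨⟨x, hx⟩, ⟨hxW, (hω ⟨x, hx⟩).2 hxB⟩, rfl⟩
  rw [hcount _ (measurableSet_inIsolatedSet 2), hcount _ (measurableSet_outIsolatedSet 2)]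
  · exact h
  · filter_upwards [hN.ae_disjoint two_ne_zero] with ω hω x
    exact outIsolated_basicGraph_iff hP hv hg (hN.eavesdroppers.config ω) hω x
  · filter_upwards [hN.ae_disjoint two_ne_zero] with ω hω x
    exact inIsolated_basicGraph_iff hP hv hg (hN.eavesdroppers.config ω) hω x

lemma measure_origin_inIsolated_lt_outIsolated {Ω : Type*} [MeasurableSpace Ω] {μ : Measure Ω} [IsProbabilityMeasure μ]
    {Nl Ne : Ω → Set (Space 2)} {ll le : ℝ≥0} (hll : 0 < ll) (hle : 0 < le)
    (hN : IsPoissonNetwork μ Nl Ne ll le)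
    {P v : ℝ} (hP : 0 < P) (hv : 0 < v) {g : ℝ → ℝ} (hg : IsPathLoss g) :
    μ {ω | InIsolated (basicGraph P v g (insert 0 (Nl ω)) (Ne ω))
        (originNode (Nl ω))} <
      μ {ω | OutIsolated (basicGraph P v g (insert 0 (Nl ω)) (Ne ω))
        (originNode (Nl ω))} := by
  have h := hN.lintegral_inIsolated_lt_outIsolated two_ne_zero hll hle
    (Kernel.const (Config 2) (Measure.dirac (0 : Space 2))) (by simp) (by simp)
  have hprob : ∀ (B : Set ((Config 2 × Config 2) × Space 2)), MeasurableSet B →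
      ∀ (A : Set Ω), (∀ᵐ ω ∂μ, ω ∈ A ↔
        ((hN.legitimate.config ω, hN.eavesdroppers.config ω), (0 : Space 2)) ∈ B) →
      μ A = ∫⁻ ω, Kernel.const (Config 2) (Measure.dirac (0 : Space 2)) (hN.legitimate.config ω)
          {x | ((hN.legitimate.config ω, hN.eavesdroppers.config ω), x) ∈ B} ∂μ := by
    intro B hB A hA
    have hm : Measurable fun ω =>
        ((hN.legitimate.config ω, hN.eavesdroppers.config ω), (0 : Space 2)) :=
      (hN.legitimate.measurable_config.prodMk hN.eavesdroppers.measurable_config).prodMk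
        measurable_const
    have h1 : ∀ ω, Kernel.const (Config 2) (Measure.dirac (0 : Space 2)) (hN.legitimate.config ω)
        {x | ((hN.legitimate.config ω, hN.eavesdroppers.config ω), x) ∈ B} =
        ((fun ω => ((hN.legitimate.config ω, hN.eavesdroppers.config ω), (0 : Space 2))) ⁻¹'
          B).indicator 1 ω := by
      intro ω
      have hBω : MeasurableSet {x | ((hN.legitimate.config ω, hN.eavesdroppers.config ω), x) ∈ B} :=
        measurable_prodMk_left hB
      rw [Kernel.const_apply, Measure.dirac_apply' _ hBω]
      rfl
    simp only [h1]
    rw [lintegral_indicator_one (hm hB)]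
    exact measure_congr (hA.mono fun ω hω => propext hω)
  have hdis : ∀ᵐ ω ∂μ, ∀ y ∈ insert 0 (Nl ω), y ∉ Ne ω := by
    filter_upwards [hN.ae_disjoint two_ne_zero, hN.eavesdroppers.ae_notMem two_ne_zero 0]
      with ω h1 h2
    rintro y (rfl | hy)
    exacts [h2, h1 y hy]
  rw [hprob _ (measurableSet_inIsolatedSet 2), hprob _ (measurableSet_outIsolatedSet 2)]
  · exact h
  · filter_upwards [hdis] with ω hω
    refine (outIsolated_basicGraph_iff hP hv hg (hN.eavesdroppers.config ω) hω _).trans ?_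
    -- The added node is the typical node itself, so the condition `y ≠ 0` removes it from the
    -- quantifier.
    exact ⟨fun h y hy hne => h y (mem_insert_of_mem _ hy) hne,
      fun h y hy hne => h y (mem_of_mem_insert_of_ne hy hne) hne⟩
  · filter_upwards [hdis] with ω hω
    refine (inIsolated_basicGraph_iff hP hv hg (hN.eavesdroppers.config ω) hω _).trans ?_
    exact ⟨fun h y hy hne => h y (mem_insert_of_mem _ hy) hne,
      fun h y hy hne => h y (mem_of_mem_insert_of_ne hy hne) hne⟩

end SecrecyGraph

theorem mainTheorem5 {Ω : Type*} [MeasurableSpace Ω] (μ : Measure Ω) [IsProbabilityMeasure μ]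
    (Nl Ne : Ω → Set (SecrecyGraph.Space 2)) (ll le : ℝ≥0) (hll : 0 < ll) (hle : 0 < le)
    (hN : SecrecyGraph.IsPoissonNetwork μ Nl Ne ll le)
    (P v : ℝ) (hP : 0 < P) (hv : 0 < v) (g : ℝ → ℝ) (hg : SecrecyGraph.IsPathLoss g) :
    (∀ W : Set (SecrecyGraph.Space 2), MeasurableSet W → volume W ≠ 0 → volume W ≠ ∞ →
      SecrecyGraph.palmProb μ Nl ll W
          (fun ω x => SecrecyGraph.InIsolated (SecrecyGraph.basicGraph P v g (Nl ω) (Ne ω)) x) <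
        SecrecyGraph.palmProb μ Nl ll W
          (fun ω x => SecrecyGraph.OutIsolated (SecrecyGraph.basicGraph P v g (Nl ω) (Ne ω)) x)) ∧
    μ {ω | SecrecyGraph.InIsolated (SecrecyGraph.basicGraph P v g (insert 0 (Nl ω)) (Ne ω))
        (SecrecyGraph.originNode (Nl ω))} <
      μ {ω | SecrecyGraph.OutIsolated (SecrecyGraph.basicGraph P v g (insert 0 (Nl ω)) (Ne ω))
        (SecrecyGraph.originNode (Nl ω))} := by
  exact ⟨fun _ hW hW0 hWt => SecrecyGraph.palmProb_inIsolated_lt_outIsolated hll hle hN hP hv hg hW hW0 hWt,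
    SecrecyGraph.measure_origin_inIsolated_lt_outIsolated hll hle hN hP hv hg⟩
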